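/- Let $\mathbb F$ be a finite field and $n\ge 1$ an integer not divisible by the characteristic of $\mathbb F$. Put $A=\mathbb F[x]/(x^n-1)$, let $\sigma$ be an $\mathbb F$-algebra automorphism of $A$, and let $\mathcal R=A[z;\sigma]$ be the ring of polynomials $\sum_{\nu\ge0} z^\nu g_\nu$ with $g_\nu\in A$, in which $az=z\sigma(a)$ for $a\in A$. Let $x^n-1=\pi_1\cdots\pi_r$ be the factorization into (pairwise different) monic prime polynomials over $\mathbb F$, and let $e_1,\dots,e_r\in A$ be the corresponding primitive idempotents, i.e. $e_k\equiv 1 \pmod{\pi_k}$ and $e_k\equiv 0\pmod{\pi_j}$ for $j\ne k$. For $g\in\mathcal R$ put $g^{(k)}=e_k g$ and $T_g=\{k: g^{(k)}\neq 0\}$, and let $\deg_z$ denote the degree in $z$. The monomials $z^\mu e_k$ are ordered by $z^\mu e_k<z^\nu e_l$ iff $\mu<\nu$, or $\mu=\nu$ and $k<l$. The terms of $f=\sum_\mu z^\mu f_\mu$ are the nonzero elements among the $z^\mu e_k f_\mu$, and the leading monomial of $f\ne0$ is the largest $z^\mu e_k$ with $e_kf_\mu\neq0$. The polynomial $g$ is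 called reduced if for all $k\neq l$ with $g^{(k)}\ne0\ne g^{(l)}$ no term of $g^{(k)}$ is right divisible in $\mathcal R$ by the leading monomial of $g^{(l)}$. For $a\in A$ let $a_0,\dots,a_{n-1}\in\mathbb F$ be its coordinates with respect to $1,x,\dots,x^{n-1}$, let $M_a=[a_{(j-i)\bmod n}]_{i,j=0}^{n-1}$, let $P_\sigma\in\mathbb F^{n\times n}$ be the matrix whose $i$-th row ($0\le i\le n-1$) consists of the coordinates of $\sigma(x^i)$, and for $g=\sum_\nu z^\nu g_\nu\in\mathcal R$ put $\mathcal M^\sigma(g)=\sum_{\nu} z^\nu P_\sigma^\nu M_{g_\nu}\in\mathbb F[z]^{n\times n}$. For a matrix $M\in\mathbb F[z]^{m\times n}$ let $\operatorname{im}M=\{uM:u\in\mathbb F[z]^m\}$; $M$ is called basic if its Smith form is $\begin{pmatrix}I_k&0\\0&0\end{pmatrix}$ with $k$ the rank of $\operatorname{im}M$. A convolutional code is a direct summand $\mathcal C$ of $\mathbb F[z]^n$. Identify $v=(v_0,\dots,v_{n-1})\in\mathbb F[z]^n$, where $v_i=\sum_\nu v_{i,\nu}z^\nu$ with $v_{i,\nu}\in\mathbb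 F$, with $\mathfrak p(v)=\sum_\nu z^\nu\sum_i v_{i,\nu}x^i\in\mathcal R$. The code $\mathcal C$ is $\sigma$-cyclic if $x\,\mathfrak p(v)\in\mathfrak p(\mathcal C)$ for all $v\in\mathcal C$. If $\mathcal C$ has rank $k$, an encoder of $\mathcal C$ is a matrix $G\in\mathbb F[z]^{k\times n}$ with $\operatorname{im}G=\mathcal C$, and the complexity of $\mathcal C$ is the maximal degree of the $k$-minors of an encoder; this does not depend on the encoder. **Corollary.** If $g\in\mathcal R$ is reduced and $\mathcal M^\sigma(g)$ is basic, then $\mathcal C:=\operatorname{im}\mathcal M^\sigma(g)$ is a $\sigma$-cyclic convolutional code, and its complexity is $$\delta=\sum_{i\in T_g}\deg_x\pi_i\cdot\deg_z g^{(i)} .$$ -/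

import Mathlib

open Polynomial

set_option linter.unusedSectionVars false

noncomputable section

namespace CyclicConv

/-! ### The algebra `A = F[x]/(x^n - 1)` -/

/-- `A = F[x]/(x^n - 1)`. -/
abbrev CycAlg (F : Type*) [Field F] (n : ℕ) : Type _ := AdjoinRoot (X ^ n - 1 : F[X])

section

variable {F : Type*} [Field F] {n : ℕ} [NeZero (n : F)]

theorem length_ne_zero (F : Type*) [Field F] (n : ℕ) [NeZero (n : F)] : n ≠ 0 := by
  rintro rfl
  exact NeZero.ne ((0 : ℕ) : F) Nat.cast_zero

theorem monic_modulus (F : Type*) [Field F] (n : ℕ) [NeZero (n : F)] :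
    (X ^ n - 1 : F[X]).Monic := by
  simpa using monic_X_pow_sub_C (1 : F) (length_ne_zero F n)

/-- The class of `x` in `A`. -/
def xA (F : Type*) [Field F] (n : ℕ) : CycAlg F n := AdjoinRoot.root (X ^ n - 1 : F[X])

/-- The coefficient vector `(a_0, …, a_{n-1})` of `a = ∑ a_i x^i ∈ A`, that is, the coefficients
of the representative of `a` of degree less than `n`. -/
def vec (a : CycAlg F n) : Fin n → F :=
  fun i => (AdjoinRoot.modByMonicHom (monic_modulus F n) a).coeff i

/-! ### The prime factors of `x^n - 1` and the primitive idempotents -/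

/-- The factorization `x^n - 1 = π_1 ⋯ π_r` into monic prime polynomials, in some order. -/
structure PrimeFactors (F : Type*) [Field F] (n r : ℕ) where
  /-- the prime factors -/
  π : Fin r → F[X]
  monic : ∀ k, (π k).Monic
  irreducible : ∀ k, Irreducible (π k)
  prod_eq : ∏ k, π k = X ^ n - 1

variable {r : ℕ}

theorem eval_modulus {F : Type*} [Field F] {n r : ℕ} (P : PrimeFactors F n r) (k : Fin r) :
    (X ^ n - 1 : F[X]).eval₂ (AdjoinRoot.of (P.π k)) (AdjoinRoot.root (P.π k)) = 0 := by
  have h : AdjoinRoot.mk (P.π k) (X ^ n - 1) = 0 := by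
    rw [AdjoinRoot.mk_eq_zero, ← P.prod_eq]
    exact Finset.dvd_prod_of_mem _ (Finset.mem_univ k)
  simpa using h

/-- Reduction modulo all the `π_k`: the map `A → K_1 × ⋯ × K_r`, `K_k = F[x]/(π_k)`. -/
def residues (P : PrimeFactors F n r) : CycAlg F n →+* ((k : Fin r) → AdjoinRoot (P.π k)) :=
  RingHom.pi fun k =>
    AdjoinRoot.lift (AdjoinRoot.of (P.π k)) (AdjoinRoot.root (P.π k)) (eval_modulus P k)

theorem residues_mk (P : PrimeFactors F n r) (f : F[X]) (k : Fin r) :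
    residues P (AdjoinRoot.mk _ f) k = AdjoinRoot.mk (P.π k) f := by
  rw [← AdjoinRoot.aeval_eq (f := P.π k) f, aeval_def, AdjoinRoot.algebraMap_eq]
  exact AdjoinRoot.lift_mk (eval_modulus P k) f

theorem pairwise_coprime (P : PrimeFactors F n r) :
    Pairwise fun i j => IsCoprime (P.π i) (P.π j) := by
  intro i j hij
  have hsep : (X ^ n - 1 : F[X]).Separable := by
    simpa using separable_X_pow_sub_C (1 : F) (NeZero.ne (n : F)) one_ne_zero
  have hd : P.π i * P.π j ∣ X ^ n - 1 := by
    rw [← P.prod_eq, ← Finset.prod_pair hij]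
    exact Finset.prod_dvd_prod_of_subset _ _ _ (Finset.subset_univ _)
  exact (hsep.of_dvd hd).isCoprime

/-- The Chinese remainder theorem for `A`. -/
theorem residues_bijective (P : PrimeFactors F n r) : Function.Bijective (residues P) := by
  constructor
  · rw [injective_iff_map_eq_zero]
    intro a ha
    induction a using AdjoinRoot.induction_on with
    | ih f =>
      rw [AdjoinRoot.mk_eq_zero, ← P.prod_eq]
      refine Finset.prod_dvd_of_coprime (fun i _ j _ hij => pairwise_coprime P hij) fun k _ => ?_
      rw [← AdjoinRoot.mk_eq_zero, ← residues_mk, ha, Pi.zero_apply]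
  · intro y
    obtain ⟨f, hf⟩ := Ideal.pi_quotient_surjective (I := fun k => Ideal.span {P.π k})
      (fun i j hij => (Ideal.isCoprime_span_singleton_iff _ _).2 (pairwise_coprime P hij)) y
    exact ⟨AdjoinRoot.mk _ f, funext fun k => (residues_mk P f k).trans (hf k)⟩

/-- The isomorphism `A ≅ K_1 × ⋯ × K_r`. -/
def decomp (P : PrimeFactors F n r) : CycAlg F n ≃+* ((k : Fin r) → AdjoinRoot (P.π k)) :=
  RingEquiv.ofBijective (residues P) (residues_bijective P)

/-- The primitive idempotent `e_k` of `A` that belongs to `π_k`: it corresponds to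
`(0, …, 0, 1, 0, …, 0)` with the `1` in the `k`-th place. -/
def idem (P : PrimeFactors F n r) (k : Fin r) : CycAlg F n := (decomp P).symm (Pi.single k 1)

end

/-! ### The Piret algebra `A[z;σ]` -/

/-- `A[z;σ]`: the elements are the polynomials `∑ z^ν g_ν` in `z`, with coefficients `g_ν ∈ A` on
the right of the powers of `z`; the multiplication is determined by `a z = z σ(a)`. -/
def Piret {F : Type*} [Field F] {n : ℕ} (_σ : CycAlg F n ≃ₐ[F] CycAlg F n) : Type _ :=
  (CycAlg F n)[X]

namespace Piret

variable {F : Type*} [Field F] {n : ℕ} {σ : CycAlg F n ≃ₐ[F] CycAlg F n}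

instance : AddCommGroup (Piret σ) := inferInstanceAs (AddCommGroup (CycAlg F n)[X])

/-- The underlying polynomial in `z`. -/
def toPoly (g : Piret σ) : (CycAlg F n)[X] := g

/-- `z^ν a`. -/
def mono (ν : ℕ) (a : CycAlg F n) : Piret σ := (monomial ν a : (CycAlg F n)[X])

/-- The coefficient `g_ν` of `z^ν`. -/
def coeff (g : Piret σ) (ν : ℕ) : CycAlg F n := g.toPoly.coeff ν

/-- The degree in `z` (for nonzero elements). -/
def degz (g : Piret σ) : ℕ := g.toPoly.natDegree

/-- `(∑ z^ν g_ν) (∑ z^μ h_μ) = ∑ z^(ν+μ) σ^μ(g_ν) h_μ`. -/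
instance : Mul (Piret σ) where
  mul g h := g.toPoly.sum fun ν a => h.toPoly.sum fun μ b => mono (ν + μ) ((σ ^ μ) a * b)

instance : One (Piret σ) where
  one := mono 0 1

theorem mul_def (g h : Piret σ) :
    g * h = g.toPoly.sum fun ν a => h.toPoly.sum fun μ b => mono (ν + μ) ((σ ^ μ) a * b) := rfl

theorem mono_add (ν : ℕ) (a b : CycAlg F n) :
    (mono ν (a + b) : Piret σ) = mono ν a + mono ν b :=
  (monomial ν : CycAlg F n →ₗ[CycAlg F n] (CycAlg F n)[X]).map_add a b

theorem mono_zero (ν : ℕ) : (mono ν 0 : Piret σ) = 0 := monomial_zero_right ν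

theorem add_mul' (f g h : Piret σ) : (f + g) * h = f * h + g * h := by
  rw [mul_def, mul_def, mul_def]
  refine sum_add_index f.toPoly g.toPoly _ (fun ν => ?_) (fun ν a b => ?_)
  · simp [Polynomial.sum_def, mono_zero]
  · simp [Polynomial.sum_def, map_add, add_mul, mono_add, Finset.sum_add_distrib]

theorem mul_add' (f g h : Piret σ) : f * (g + h) = f * g + f * h := by
  rw [mul_def, mul_def, mul_def, Polynomial.sum_def, Polynomial.sum_def, Polynomial.sum_def,
    ← Finset.sum_add_distrib]
  refine Finset.sum_congr rfl fun ν _ => ?_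
  refine sum_add_index g.toPoly h.toPoly _ (fun μ => ?_) (fun μ a b => ?_)
  · simp [mono_zero]
  · simp [mul_add, mono_add]

theorem mono_mul_mono (ν μ : ℕ) (a b : CycAlg F n) :
    (mono ν a * mono μ b : Piret σ) = mono (ν + μ) ((σ ^ μ) a * b) := by
  rw [mul_def]
  refine (sum_monomial_index (n := ν) a _ ?_).trans (sum_monomial_index (n := μ) b _ ?_)
  · simp [Polynomial.sum_def, mono_zero]
  · simp [mono_zero]

theorem ind (p : Piret σ → Prop) (g : Piret σ) (hadd : ∀ f g, p f → p g → p (f + g))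
    (hmono : ∀ ν a, p (mono ν a)) : p g :=
  Polynomial.induction_on' (motive := p) g hadd hmono

theorem zero_mul' (g : Piret σ) : 0 * g = 0 := by
  have h := add_mul' (0 : Piret σ) 0 g
  simpa using h

theorem mul_zero' (g : Piret σ) : g * 0 = 0 := by
  have h := mul_add' g 0 0
  simpa using h

instance : Ring (Piret σ) :=
  { (inferInstance : AddCommGroup (Piret σ)), (inferInstance : Mul (Piret σ)),
    (inferInstance : One (Piret σ)) with
    left_distrib := mul_add'
    right_distrib := add_mul'
    zero_mul := zero_mul'
    mul_zero := mul_zero'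
    one_mul := fun g => ind (fun g => 1 * g = g) g (fun f g hf hg => by rw [mul_add', hf, hg]) fun ν a => by
      change mono 0 1 * mono ν a = _
      simp [mono_mul_mono]
    mul_one := fun g => ind (fun g => g * 1 = g) g (fun f g hf hg => by rw [add_mul', hf, hg]) fun ν a => by
      change mono ν a * mono 0 1 = _
      simp [mono_mul_mono]
    mul_assoc := fun f g h => by
      refine ind (fun f => f * g * h = f * (g * h)) f (fun f₁ f₂ h₁ h₂ => by rw [add_mul', add_mul', add_mul', h₁, h₂]) fun ν a => ?_
      refine ind (fun g => mono ν a * g * h = mono ν a * (g * h)) g (fun f₁ f₂ h₁ h₂ => by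
        rw [mul_add', add_mul', add_mul', mul_add', h₁, h₂]) fun μ b => ?_
      refine ind (fun h => mono ν a * mono μ b * h = mono ν a * (mono μ b * h)) h (fun f₁ f₂ h₁ h₂ => by rw [mul_add', mul_add', mul_add', h₁, h₂]) fun κ c => ?_
      simp only [mono_mul_mono, map_mul, add_assoc, mul_assoc, ← AlgEquiv.mul_apply, ← pow_add,
        add_comm κ μ] }

variable [NeZero (n : F)] {r : ℕ}

/-- The `k`-th component `g^(k) = e_k g`. -/
def comp (P : PrimeFactors F n r) (g : Piret σ) (k : Fin r) : Piret σ := mono 0 (idem P k) * g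

open scoped Classical in
/-- The support `T_g = {k | g^(k) ≠ 0}`. -/
def supp (P : PrimeFactors F n r) (g : Piret σ) : Finset (Fin r) :=
  Finset.univ.filter fun k => comp P g k ≠ 0

/-! ### Monomials, leading monomials, reducedness -/

open scoped Classical in
/-- The pairs `(μ, k)` for which the term `z^μ e_k f_μ` of `f` is nonzero. The order is that of the
monomials: `z^μ e_k < z^ν e_l` iff `μ < ν`, or `μ = ν` and `k < l`. -/
def termSupport (P : PrimeFactors F n r) (f : Piret σ) : Finset (ℕ ×ₗ Fin r) :=
  ((f.toPoly.support ×ˢ Finset.univ).map toLex.toEmbedding).filter fun q =>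
    idem P (ofLex q).2 * f.coeff (ofLex q).1 ≠ 0

/-- The term `z^μ e_k f_μ` of `f` at `q = (μ, k)`. -/
def term (P : PrimeFactors F n r) (f : Piret σ) (q : ℕ ×ₗ Fin r) : Piret σ :=
  mono (ofLex q).1 (idem P (ofLex q).2 * f.coeff (ofLex q).1)

open scoped Classical in
/-- The leading monomial of a nonzero `f`: the largest `z^μ e_k` with `e_k f_μ ≠ 0`. -/
def leadMono (P : PrimeFactors F n r) (f : Piret σ) : Piret σ :=
  if h : (termSupport P f).Nonempty then
    mono (ofLex ((termSupport P f).max' h)).1 (idem P (ofLex ((termSupport P f).max' h)).2)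
  else 0

/-- A family is (left) reduced if, for any two different indices `k`, `l` with nonzero members, no
nonzero term of `f_k` is right divisible by the leading monomial of `f_l`. -/
def ReducedFamily (P : PrimeFactors F n r) {s : ℕ} (f : Fin s → Piret σ) : Prop :=
  ∀ k l, k ≠ l → f k ≠ 0 → f l ≠ 0 →
    ∀ q ∈ termSupport P (f k), ¬ ∃ h : Piret σ, term P (f k) q = h * leadMono P (f l)

/-- `g` is (left) reduced if the family `g^(1), …, g^(r)` is. -/
def Reduced (P : PrimeFactors F n r) (g : Piret σ) : Prop := ReducedFamily P (comp P g)

end Piret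

/-! ### Circulant matrices -/

/-- The circulant matrix `M_a`, with entry `a_{(j - i) mod n}` at `(i, j)`. -/
def circ {F : Type*} [Field F] {n : ℕ} [NeZero (n : F)] (a : CycAlg F n) :
    Matrix (Fin n) (Fin n) F :=
  Matrix.of fun i j => vec a (j - i)

/-- The matrix `P_σ` with rows the coefficient vectors of `σ(x^i)`. -/
def autMatrix {F : Type*} [Field F] {n : ℕ} [NeZero (n : F)] (σ : CycAlg F n ≃ₐ[F] CycAlg F n) :
    Matrix (Fin n) (Fin n) F :=
  Matrix.of fun i => vec (σ (xA F n ^ (i : ℕ)))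

/-- The `σ`-circulant `M^σ(g) = ∑ z^ν P_σ^ν M_{g_ν}`. -/
def sigmaCirc {F : Type*} [Field F] {n : ℕ} [NeZero (n : F)] {σ : CycAlg F n ≃ₐ[F] CycAlg F n}
    (g : Piret σ) : Matrix (Fin n) (Fin n) F[X] :=
  g.toPoly.sum fun ν a => (X ^ ν : F[X]) • (autMatrix σ ^ ν * circ a).map C

/-! ### Convolutional codes -/

section

variable {F : Type*} [Field F] {n : ℕ}

/-- `im M = {u M | u ∈ F[z]^m}` (row vectors). -/
def im {m : ℕ} (M : Matrix (Fin m) (Fin n) F[X]) : Submodule F[X] (Fin n → F[X]) :=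
  LinearMap.range M.vecMulLinear

/-- `M` is basic if its Smith form is `[[I_k, 0], [0, 0]]`, where `k` is the rank of `im M`. -/
def Basic {m : ℕ} (M : Matrix (Fin m) (Fin n) F[X]) : Prop :=
  ∃ (U : (Matrix (Fin m) (Fin m) F[X])ˣ) (W : (Matrix (Fin n) (Fin n) F[X])ˣ),
    U.val * M * W.val = Matrix.of fun (i : Fin m) (j : Fin n) =>
      if (i : ℕ) = (j : ℕ) ∧ (i : ℕ) < Module.finrank F[X] (im M) then 1 else 0

/-- A convolutional code of length `n` is a direct summand of `F[z]^n`. -/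
def IsConvCode (V : Submodule F[X] (Fin n → F[X])) : Prop := ∃ W, IsCompl V W

/-- The polynomial form `∑_ν z^ν ∑_i v_{i,ν} x^i` of a vector `v ∈ F[z]^n`, where `v_{i,ν}` is the
coefficient of `z^ν` in `v_i`. -/
def polyForm (σ : CycAlg F n ≃ₐ[F] CycAlg F n) (v : Fin n → F[X]) : Piret σ :=
  ∑ i, (v i).sum fun ν c => Piret.mono ν (c • xA F n ^ (i : ℕ))

/-- `V` is `σ`-cyclic if its polynomial form is closed under left multiplication by `x`. -/
def IsSigmaCyclic (σ : CycAlg F n ≃ₐ[F] CycAlg F n) (V : Submodule F[X] (Fin n → F[X])) : Prop :=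
  ∀ v ∈ V, ∃ w ∈ V, polyForm σ w = Piret.mono 0 (xA F n) * polyForm σ v

/-- A `k × n` matrix is an encoder (generator matrix) of `V` if `im G = V` and the rank is `k`. -/
def IsEncoder {k : ℕ} (G : Matrix (Fin k) (Fin n) F[X]) (V : Submodule F[X] (Fin n → F[X])) :
    Prop :=
  im G = V ∧ Module.finrank F[X] V = k

/-- The maximal degree of the `k`-minors of a `k × n` matrix. -/
def maxMinorDegree {k : ℕ} (G : Matrix (Fin k) (Fin n) F[X]) : ℕ :=
  Finset.univ.sup fun s : Fin k ↪o Fin n => (G.submatrix id s).det.natDegree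

/-- `δ` is the complexity of `V`: the maximal degree of the `k`-minors of an encoder of `V`. There
is an encoder, and the value is the same for all of them. -/
def HasComplexity (V : Submodule F[X] (Fin n → F[X])) (δ : ℕ) : Prop :=
  (∃ (k : ℕ) (G : Matrix (Fin k) (Fin n) F[X]), IsEncoder G V) ∧
    ∀ (k : ℕ) (G : Matrix (Fin k) (Fin n) F[X]), IsEncoder G V → maxMinorDegree G = δ

end

end CyclicConv

end

noncomputable section

namespace CyclicConv

/-! ### Minors of polynomial matrices -/

section Minors

variable {F : Type*} [Field F]

/-! In coordinates, right multiplication by `g` on `A[z;σ]` is the matrix `sigmaCirc g`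
(`coords_vecMul_sigmaCirc`), so the code is the left ideal generated by `g`. A left ideal is closed
under left multiplication by `x`, which gives `σ`-cyclicity. Basicness gives the direct summand: the
image is that of an idempotent matrix.

For the complexity, take as rows the elements `x^i e_k g` with `k ∈ T_g` and `i < deg π_k`; they
generate the code over `F[z]` (`span_coords_gen`). Put `d_k = deg_z g^(k)`. The row of `x^i e_k g`
has degree at most `d_k`, and its coefficient at `z^(d_k)` lies in the component of `σ^(d_k)(e_k)`,
again a primitive idempotent `e_(m_k)`. Reducedness says precisely what is needed: the `m_k` are
pairwise different (`Reduced.idem_ne`). Thus rows with different `k` have top coefficients in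
different components. Within one component, which is a field, the top coefficient of `g^(k)` acts
injectively. Hence the matrix is row reduced (`linearIndependent_leading`), and its maximal minors
attain the sum of the row degrees, where each `k` contributes `deg π_k` times `d_k`. -/

theorem natDegree_prod_le_sum {ι : Type*} (s : Finset ι) (f : ι → F[X]) (d : ι → ℕ)
    (h : ∀ i, (f i).natDegree ≤ d i) : (∏ i ∈ s, f i).natDegree ≤ ∑ i ∈ s, d i :=
  (natDegree_prod_le s f).trans (Finset.sum_le_sum fun i _ => h i)

theorem coeff_prod_sum {ι : Type*} (s : Finset ι) (f : ι → F[X]) (d : ι → ℕ)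
    (h : ∀ i, (f i).natDegree ≤ d i) :
    (∏ i ∈ s, f i).coeff (∑ i ∈ s, d i) = ∏ i ∈ s, (f i).coeff (d i) := by
  classical
  induction s using Finset.induction_on with
  | empty => simp
  | insert a s ha ih =>
    rw [Finset.prod_insert ha, Finset.sum_insert ha, Finset.prod_insert ha,
      coeff_mul_add_eq_of_natDegree_le (h a) (natDegree_prod_le_sum s f d h), ih]

variable {k n : ℕ}

theorem natDegree_det_le_sum (G : Matrix (Fin k) (Fin k) F[X]) (d : Fin k → ℕ)
    (h : ∀ i j, (G i j).natDegree ≤ d i) : G.det.natDegree ≤ ∑ i, d i := by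
  -- After transposing, each Leibniz product is indexed by rows, which is how the bounds `d i` are
  -- indexed.
  rw [← Matrix.det_transpose, Matrix.det_apply]
  refine natDegree_sum_le_of_forall_le _ _ fun τ _ => ?_
  refine (natDegree_smul_le _ _).trans ?_
  exact natDegree_prod_le_sum Finset.univ (fun i => G i (τ i)) d fun i => h i _

theorem coeff_det_sum (G : Matrix (Fin k) (Fin k) F[X]) (d : Fin k → ℕ)
    (h : ∀ i j, (G i j).natDegree ≤ d i) :
    G.det.coeff (∑ i, d i) = (Matrix.of fun i j => (G i j).coeff (d i)).det := by
  rw [← Matrix.det_transpose, Matrix.det_apply, ← Matrix.det_transpose, Matrix.det_apply,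
    finsetSum_coeff]
  refine Finset.sum_congr rfl fun τ _ => ?_
  rw [coeff_smul]
  congr 1
  exact coeff_prod_sum Finset.univ (fun i => G i (τ i)) d fun i => h i _

theorem exists_det_submatrix_ne_zero (L : Matrix (Fin k) (Fin n) F)
    (hL : LinearIndependent F L.row) : ∃ s : Fin k ↪o Fin n, (L.submatrix id s).det ≠ 0 := by
  have hr : Module.finrank F (Submodule.span F (Set.range L.col)) = k := by
    rw [← Matrix.rank_eq_finrank_span_cols, hL.rank_matrix, Fintype.card_fin]
  obtain ⟨f, hf, -, hli⟩ := Submodule.exists_fun_fin_finrank_span_eq F (Set.range L.col)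
  choose c hc using hf
  let c' : Fin k → Fin n := c ∘ Fin.cast hr.symm
  have hli' : LinearIndependent F fun i => L.col (c' i) := by
    have hcf : (fun i => L.col (c' i)) = f ∘ Fin.cast hr.symm := funext fun i => hc _
    rw [hcf]
    exact hli.comp _ (Fin.cast_injective hr.symm)
  have hinj : Function.Injective c' := fun a b hab => hli'.injective (by simp only [hab])
  -- Minors are indexed by increasing column choices; sorting only permutes the chosen columns and
  -- keeps them independent.
  have hmono : StrictMono (c' ∘ Tuple.sort c') :=
    (Tuple.monotone_sort c').strictMono_of_injective (hinj.comp (Equiv.injective _))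
  refine ⟨OrderEmbedding.ofStrictMono _ hmono, ?_⟩
  have h2 : LinearIndependent F
      (L.submatrix id (OrderEmbedding.ofStrictMono _ hmono)).col :=
    hli'.comp _ (Tuple.sort c').injective
  rw [Matrix.linearIndependent_cols_iff_isUnit, Matrix.isUnit_iff_isUnit_det] at h2
  exact h2.ne_zero

/-- In a row reduced matrix the maximal degree of the full-size minors is the sum of the row
degrees. -/
theorem maxMinorDegree_of_rowReduced (G : Matrix (Fin k) (Fin n) F[X]) (d : Fin k → ℕ)
    (h : ∀ i j, (G i j).natDegree ≤ d i)
    (hL : LinearIndependent F fun i j => (G i j).coeff (d i)) :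
    maxMinorDegree G = ∑ i, d i := by
  refine le_antisymm (Finset.sup_le fun s _ =>
    natDegree_det_le_sum (G.submatrix id s) d fun i j => h i _) ?_
  obtain ⟨s, hs⟩ := exists_det_submatrix_ne_zero (Matrix.of fun i j => (G i j).coeff (d i)) hL
  refine le_trans ?_ (Finset.le_sup (f := fun s : Fin k ↪o Fin n =>
    (G.submatrix id s).det.natDegree) (Finset.mem_univ s))
  refine le_natDegree_of_ne_zero ?_
  rw [coeff_det_sum (G.submatrix id s) d fun i j => h i _]
  exact hs

/-- Some minor has a nonzero coefficient at the sum of the `d i`, so the rows are independent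
already after restriction to its columns. -/
theorem linearIndependent_of_rowReduced (G : Matrix (Fin k) (Fin n) F[X]) (d : Fin k → ℕ)
    (h : ∀ i j, (G i j).natDegree ≤ d i)
    (hL : LinearIndependent F fun i j => (G i j).coeff (d i)) :
    LinearIndependent F[X] G.row := by
  obtain ⟨s, hs⟩ := exists_det_submatrix_ne_zero (Matrix.of fun i j => (G i j).coeff (d i)) hL
  have hdet : (G.submatrix id s).det ≠ 0 := by
    intro h0
    have := coeff_det_sum (G.submatrix id s) d fun i j => h i _
    rw [h0, coeff_zero] at this
    exact hs this.symm
  refine LinearIndependent.of_comp (LinearMap.funLeft F[X] F[X] s) ?_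
  exact Matrix.linearIndependent_rows_of_det_ne_zero hdet

/-! ### Change of encoder -/

theorem exists_mul_of_im_le {m : ℕ} {G : Matrix (Fin k) (Fin n) F[X]}
    {G' : Matrix (Fin m) (Fin n) F[X]} (h : im G ≤ im G') :
    ∃ U : Matrix (Fin k) (Fin m) F[X], G = U * G' := by
  have : ∀ i, ∃ u : Fin m → F[X], Matrix.vecMul u G' = G i := fun i =>
    h ⟨Pi.single i 1, by simp [Matrix.row_def]⟩
  choose U hU using this
  exact ⟨Matrix.of U, funext fun i => (hU i).symm⟩

theorem im_mul_le {m l : ℕ} (U : Matrix (Fin l) (Fin m) F[X]) (G : Matrix (Fin m) (Fin n) F[X]) :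
    im (U * G) ≤ im G := by
  rintro _ ⟨u, rfl⟩
  exact ⟨Matrix.vecMul u U, by simp⟩

/-- Each matrix is a multiple of the other, so corresponding minors differ by the factors `det U`
and `det U'`, which are constants once some minor is nonzero. -/
theorem maxMinorDegree_eq_of_im_eq {G G' : Matrix (Fin k) (Fin n) F[X]} (h : im G = im G') :
    maxMinorDegree G = maxMinorDegree G' := by
  obtain ⟨U, hU⟩ := exists_mul_of_im_le h.le
  obtain ⟨U', hU'⟩ := exists_mul_of_im_le h.ge
  refine Finset.sup_congr rfl fun s _ => ?_
  have h1 : (G.submatrix id s).det = U.det * (G'.submatrix id s).det := by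
    rw [← Matrix.det_mul]
    conv_lhs => rw [hU]
    rfl
  have h2 : (G'.submatrix id s).det = U'.det * (G.submatrix id s).det := by
    rw [← Matrix.det_mul]
    conv_lhs => rw [hU']
    rfl
  -- Without a rank assumption `U * U' = 1` can fail; `det U * det U' = 1` comes from cancelling a
  -- nonzero minor.
  by_cases h0 : (G.submatrix id s).det = 0
  · rw [h0] at h2
    rw [h0, h2, mul_zero]
  · have hunit : U.det * U'.det = 1 := by
      refine mul_right_cancel₀ h0 ?_
      rw [mul_assoc, ← h2, ← h1, one_mul]
    have hd : U'.det.natDegree = 0 :=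
      natDegree_eq_zero_of_isUnit (IsUnit.of_mul_eq_one_right _ hunit)
    have hne : U'.det ≠ 0 := right_ne_zero_of_mul_eq_one hunit
    rw [h2, natDegree_mul hne h0, hd, zero_add]

theorem hasComplexity_of_rowReduced {V : Submodule F[X] (Fin n → F[X])}
    (G : Matrix (Fin k) (Fin n) F[X]) (d : Fin k → ℕ)
    (h : ∀ i j, (G i j).natDegree ≤ d i)
    (hL : LinearIndependent F fun i j => (G i j).coeff (d i)) (hV : im G = V) :
    HasComplexity V (∑ i, d i) := by
  have hk : Module.finrank F[X] V = k := by
    rw [← hV, im, range_vecMulLinear,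
      finrank_span_eq_card (linearIndependent_of_rowReduced G d h hL), Fintype.card_fin]
  refine ⟨⟨k, G, hV, hk⟩, ?_⟩
  rintro k' G' ⟨hG', hk'⟩
  obtain rfl : k = k' := hk.symm.trans hk'
  rw [maxMinorDegree_eq_of_im_eq (hG'.trans hV.symm), maxMinorDegree_of_rowReduced G d h hL]

/-- From `U M W = D` with `D` idempotent, `W D W⁻¹` is idempotent and has the same image as `M`; its
kernel is a complement. -/
theorem isConvCode_of_basic {M : Matrix (Fin n) (Fin n) F[X]} (hM : Basic M) :
    IsConvCode (im M) := by
  obtain ⟨U, W, hUW⟩ := hM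
  set D : Matrix (Fin n) (Fin n) F[X] := Matrix.diagonal fun i =>
    if (i : ℕ) < Module.finrank F[X] (im M) then 1 else 0 with hD
  have hUW' : U.val * M * W.val = D := by
    rw [hUW]
    ext i j
    by_cases hij : i = j
    · subst hij; simp [hD]
    · simp [hD, hij, Fin.val_inj]
  have hDD : D * D = D := by simp [hD]
  have hQ : W.val * U.val * M = W.val * D * W⁻¹.val := by
    rw [← hUW']
    simp only [mul_assoc, Units.mul_inv, mul_one]
  have hQQ : W.val * D * W⁻¹.val * (W.val * D * W⁻¹.val) = W.val * D * W⁻¹.val := by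
    calc _ = W.val * D * (W⁻¹.val * W.val) * D * W⁻¹.val := by simp only [mul_assoc]
      _ = _ := by rw [Units.inv_mul, mul_one, mul_assoc W.val, hDD]
  have him : im M = im (W.val * D * W⁻¹.val) := by
    refine le_antisymm ?_ (hQ ▸ im_mul_le _ _)
    have : M = (U⁻¹.val * W⁻¹.val) * (W.val * D * W⁻¹.val) := by
      rw [← hQ]
      simp only [mul_assoc, Units.inv_mul_cancel_left]
    conv_lhs => rw [this]
    exact im_mul_le _ _
  have hidem : IsIdempotentElem (W.val * D * W⁻¹.val).vecMulLinear := by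
    refine LinearMap.ext fun v => ?_
    change Matrix.vecMul (Matrix.vecMul v (W.val * D * W⁻¹.val)) (W.val * D * W⁻¹.val) =
      Matrix.vecMul v (W.val * D * W⁻¹.val)
    rw [Matrix.vecMul_vecMul, hQQ]
  rw [him]
  exact ⟨_, LinearMap.IsIdempotentElem.isCompl hidem⟩

end Minors


section Algebra

variable {F : Type*} [Field F] {n : ℕ} [NeZero (n : F)]

/-! ### Coefficient vectors -/

/-- `vec` as a linear map. -/
def vecLin (F : Type*) [Field F] (n : ℕ) [NeZero (n : F)] : CycAlg F n →ₗ[F] (Fin n → F) :=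
  (LinearMap.pi fun i : Fin n => lcoeff F (i : ℕ)) ∘ₗ
    AdjoinRoot.modByMonicHom (monic_modulus F n)

theorem vecLin_apply (a : CycAlg F n) : vecLin F n a = vec a := rfl

theorem vec_mk (f : F[X]) (i : Fin n) :
    vec (AdjoinRoot.mk (X ^ n - 1) f) i = (f %ₘ (X ^ n - 1)).coeff i := by
  rw [vec, AdjoinRoot.modByMonicHom_mk]

theorem natDegree_modulus : (X ^ n - 1 : F[X]).natDegree = n := by
  simpa using natDegree_X_pow_sub_C (n := n) (r := (1 : F))

theorem degree_modulus : (X ^ n - 1 : F[X]).degree = n := by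
  rw [degree_eq_natDegree (monic_modulus F n).ne_zero, natDegree_modulus]

theorem xA_pow (i : ℕ) : xA F n ^ i = AdjoinRoot.mk (X ^ n - 1) (X ^ i) := by
  rw [map_pow, AdjoinRoot.mk_X, xA]

theorem xA_pow_length : xA F n ^ n = 1 := by
  rw [xA_pow, ← sub_eq_zero, ← map_one (AdjoinRoot.mk (X ^ n - 1 : F[X])), ← map_sub,
    AdjoinRoot.mk_self]

theorem vec_xA_pow (i : Fin n) : vec (xA F n ^ (i : ℕ)) = Pi.single i 1 := by
  funext j
  rw [xA_pow, vec_mk, (modByMonic_eq_self_iff (monic_modulus F n)).2, coeff_X_pow,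
    Pi.single_apply]
  · simp [Fin.ext_iff]
  · rw [degree_modulus, degree_X_pow]
    exact_mod_cast i.2

theorem vec_sum_smul (c : Fin n → F) : vec (∑ i, c i • xA F n ^ (i : ℕ)) = c := by
  rw [← vecLin_apply, map_sum]
  simp only [map_smul, vecLin_apply, vec_xA_pow]
  exact (pi_eq_sum_univ' c).symm

theorem sum_vec_smul (a : CycAlg F n) : ∑ i, vec a i • xA F n ^ (i : ℕ) = a := by
  have h : ∀ b : CycAlg F n, vec b = 0 → b = 0 := by
    intro b hb
    induction b using AdjoinRoot.induction_on with
    | ih f =>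
      rw [AdjoinRoot.mk_eq_zero, ← modByMonic_eq_zero_iff_dvd (monic_modulus F n)]
      ext j
      rw [coeff_zero]
      by_cases hj : j < n
      · have := congrFun hb ⟨j, hj⟩
        rwa [vec_mk] at this
      · refine coeff_eq_zero_of_degree_lt ((degree_modByMonic_lt f (monic_modulus F n)).trans_le ?_)
        rw [degree_modulus]
        exact_mod_cast not_lt.1 hj
  rw [← sub_eq_zero]
  apply h
  rw [← vecLin_apply, map_sub, vecLin_apply, vecLin_apply, vec_sum_smul, sub_self]

theorem vec_injective : Function.Injective (vec : CycAlg F n → Fin n → F) := fun a b hab => by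
  rw [← sum_vec_smul a, hab, sum_vec_smul]

theorem xA_pow_mod (i : ℕ) : xA F n ^ (i % n) = xA F n ^ i := by
  conv_rhs => rw [← Nat.mod_add_div i n, pow_add, pow_mul, xA_pow_length, one_pow, mul_one]

/-- Subtraction in `Fin n` is modulo `n`, matching `x^n = 1`. -/
theorem vec_xA_pow_mul (i : Fin n) (b : CycAlg F n) (j : Fin n) :
    vec (xA F n ^ (i : ℕ) * b) j = vec b (j - i) := by
  have : NeZero n := ⟨length_ne_zero F n⟩
  have h : xA F n ^ (i : ℕ) * b = ∑ l : Fin n, vec b (l - i) • xA F n ^ (l : ℕ) := by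
    conv_lhs => rw [← sum_vec_smul b, Finset.mul_sum]
    refine Fintype.sum_equiv (Equiv.addRight i) _ _ fun l => ?_
    rw [Equiv.coe_addRight, add_sub_cancel_right, mul_smul_comm, ← pow_add, Fin.val_add,
      xA_pow_mod, add_comm]
  rw [h, vec_sum_smul]

theorem vec_vecMul_circ (a b : CycAlg F n) : Matrix.vecMul (vec a) (circ b) = vec (a * b) := by
  funext j
  conv_rhs => rw [← sum_vec_smul a, Finset.sum_mul, ← vecLin_apply, map_sum]
  simp [Matrix.vecMul, dotProduct, circ, vecLin_apply, vec_xA_pow_mul, Finset.sum_apply]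

theorem vec_vecMul_autMatrix (σ : CycAlg F n ≃ₐ[F] CycAlg F n) (a : CycAlg F n) :
    Matrix.vecMul (vec a) (autMatrix σ) = vec (σ a) := by
  funext j
  conv_rhs => rw [← sum_vec_smul a, map_sum, ← vecLin_apply, map_sum]
  simp [Matrix.vecMul, dotProduct, autMatrix, vecLin_apply, Finset.sum_apply]

theorem vec_vecMul_autMatrix_pow (σ : CycAlg F n ≃ₐ[F] CycAlg F n) (ν : ℕ) (a : CycAlg F n) :
    Matrix.vecMul (vec a) (autMatrix σ ^ ν) = vec ((σ ^ ν) a) := by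
  induction ν with
  | zero => simp
  | succ ν ih =>
    rw [pow_succ, ← Matrix.vecMul_vecMul, ih, vec_vecMul_autMatrix, pow_succ', AlgEquiv.mul_apply]

/-! ### The coordinate map `A[z;σ] → F[z]^n` -/

namespace Piret

variable {σ : CycAlg F n ≃ₐ[F] CycAlg F n}

theorem ext_coeff {f g : Piret σ} (h : ∀ ν, f.coeff ν = g.coeff ν) : f = g :=
  Polynomial.ext h

theorem coeff_add (f g : Piret σ) (ν : ℕ) : (f + g).coeff ν = f.coeff ν + g.coeff ν :=
  Polynomial.coeff_add _ _ _

/-- The coefficient of `z^ν`, as an additive map. -/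
def coeffHom (σ : CycAlg F n ≃ₐ[F] CycAlg F n) (ν : ℕ) : Piret σ →+ CycAlg F n where
  toFun f := f.coeff ν
  map_zero' := Polynomial.coeff_zero ν
  map_add' f g := coeff_add f g ν

theorem coeff_sum {ι : Type*} (s : Finset ι) (f : ι → Piret σ) (ν : ℕ) :
    (∑ i ∈ s, f i).coeff ν = ∑ i ∈ s, (f i).coeff ν :=
  map_sum (coeffHom σ ν) f s

theorem coeff_mono (ν μ : ℕ) (a : CycAlg F n) :
    (mono ν a : Piret σ).coeff μ = if ν = μ then a else 0 :=
  coeff_monomial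

theorem coeff_mono_zero_mul (a : CycAlg F n) (f : Piret σ) (ν : ℕ) :
    (mono 0 a * f).coeff ν = (σ ^ ν) a * f.coeff ν := by
  refine ind (fun f => (mono 0 a * f).coeff ν = (σ ^ ν) a * f.coeff ν) f
    (fun f g hf hg => ?_) fun μ b => ?_
  · rw [mul_add, coeff_add, hf, hg, coeff_add, mul_add]
  · rw [mono_mul_mono, zero_add, coeff_mono, coeff_mono]
    split_ifs with h
    · rw [h]
    · rw [mul_zero]

/-- `z^ν`-coefficientwise coordinates of an element of `A[z;σ]`, the inverse of `polyForm`. -/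
def coords (f : Piret σ) : Fin n → F[X] := fun j => f.toPoly.sum fun ν a => monomial ν (vec a j)

theorem coeff_coords (f : Piret σ) (j : Fin n) (ν : ℕ) :
    (coords f j).coeff ν = vec (f.coeff ν) j := by
  have h0 : vec (0 : CycAlg F n) j = 0 := by rw [← vecLin_apply, map_zero]; rfl
  rw [coords, Polynomial.sum_def, finsetSum_coeff]
  simp only [coeff_monomial, Finset.sum_ite_eq', mem_support_iff]
  split_ifs with h
  · rfl
  · rw [coeff, not_not.1 h, h0]

theorem coords_add (f g : Piret σ) : coords (f + g) = coords f + coords g := by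
  funext j
  ext ν
  rw [coeff_coords, coeff_add, Pi.add_apply, Polynomial.coeff_add, coeff_coords, coeff_coords,
    ← vecLin_apply, map_add]
  rfl

/-- `coords` as an additive map. -/
def coordsHom (σ : CycAlg F n ≃ₐ[F] CycAlg F n) : Piret σ →+ (Fin n → F[X]) :=
  AddMonoidHom.mk' coords coords_add

theorem coords_sum {ι : Type*} (s : Finset ι) (f : ι → Piret σ) :
    coords (∑ i ∈ s, f i) = ∑ i ∈ s, coords (f i) :=
  map_sum (coordsHom σ) f s

theorem coords_zero : coords (0 : Piret σ) = 0 := map_zero (coordsHom σ)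

theorem coords_mono (ν : ℕ) (a : CycAlg F n) :
    coords (mono ν a : Piret σ) = fun j => monomial ν (vec a j) := by
  funext j
  ext μ
  rw [coeff_coords, coeff_mono, coeff_monomial]
  split_ifs
  · rfl
  · rw [← vecLin_apply, map_zero]; rfl

/-- Coefficients stand to the right of `z`, so left multiplication by `z^ν` involves no twist by
`σ`; this makes left ideals `F[z]`-modules. -/
theorem coords_mono_one_mul (f : Piret σ) (ν : ℕ) :
    coords (mono ν 1 * f) = (X ^ ν : F[X]) • coords f := by
  refine ind (fun f => coords (mono ν 1 * f) = (X ^ ν : F[X]) • coords f) f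
    (fun f g hf hg => ?_) fun μ b => ?_
  · rw [mul_add, coords_add, hf, hg, coords_add, smul_add]
  · rw [mono_mul_mono, map_one, one_mul, coords_mono, coords_mono]
    funext j
    simp [X_pow_mul_monomial, add_comm]

theorem coords_smul_mul (c : F) (a : CycAlg F n) (f : Piret σ) :
    coords (mono 0 (c • a) * f) = (C c : F[X]) • coords (mono 0 a * f) := by
  funext j
  ext ν
  rw [coeff_coords, coeff_mono_zero_mul, map_smul, smul_mul_assoc, ← vecLin_apply, map_smul,
    Pi.smul_apply, Pi.smul_apply, smul_eq_mul, smul_eq_mul, coeff_C_mul, coeff_coords,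
    coeff_mono_zero_mul, vecLin_apply]

theorem coeff_polyForm (v : Fin n → F[X]) (ν : ℕ) :
    (polyForm σ v).coeff ν = ∑ i, (v i).coeff ν • xA F n ^ (i : ℕ) := by
  rw [polyForm, coeff_sum]
  refine Finset.sum_congr rfl fun i _ => ?_
  rw [Polynomial.sum_def, coeff_sum]
  simp only [coeff_mono, Finset.sum_ite_eq', mem_support_iff]
  split_ifs with h
  · rfl
  · rw [notMem_support_iff.1 h, zero_smul]

theorem polyForm_coords (f : Piret σ) : polyForm σ (coords f) = f :=
  ext_coeff fun ν => by simp only [coeff_polyForm, coeff_coords, sum_vec_smul]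

theorem coords_polyForm (v : Fin n → F[X]) : coords (polyForm σ v) = v := by
  funext j
  ext ν
  rw [coeff_coords, coeff_polyForm, vec_sum_smul]

/-! ### The `σ`-circulant as right multiplication -/

theorem sigmaCirc_mono (ν : ℕ) (a : CycAlg F n) :
    sigmaCirc (mono ν a : Piret σ) = (X ^ ν : F[X]) • (autMatrix σ ^ ν * circ a).map C := by
  refine sum_monomial_index (n := ν) a _ ?_
  have : circ (0 : CycAlg F n) = 0 := by
    ext i j
    rw [circ, Matrix.of_apply, ← vecLin_apply, map_zero]; rfl
  simp [this]

theorem sigmaCirc_add (f g : Piret σ) : sigmaCirc (f + g) = sigmaCirc f + sigmaCirc g := by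
  have h0 : circ (0 : CycAlg F n) = 0 := by
    ext i j
    rw [circ, Matrix.of_apply, ← vecLin_apply, map_zero]; rfl
  have hadd : ∀ a b : CycAlg F n, circ (a + b) = circ a + circ b := by
    intro a b
    ext i j
    rw [circ, Matrix.of_apply, ← vecLin_apply, map_add]; rfl
  refine sum_add_index f.toPoly g.toPoly _ (fun ν => ?_) fun ν a b => ?_
  · simp [h0]
  · rw [hadd, mul_add, Matrix.map_add _ (fun a b => C_add), smul_add]

/-- On monomials, `P_σ^μ M_b` performs on coordinates the passage from `a` to `σ^μ(a) b`, which is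
the multiplication rule of `A[z;σ]`. -/
theorem coords_vecMul_sigmaCirc (f g : Piret σ) :
    Matrix.vecMul (coords f) (sigmaCirc g) = coords (f * g) := by
  refine ind (fun f => Matrix.vecMul (coords f) (sigmaCirc g) = coords (f * g)) f
    (fun f₁ f₂ h₁ h₂ => ?_) fun ν a => ?_
  · rw [coords_add, Matrix.add_vecMul, h₁, h₂, add_mul, coords_add]
  refine ind (fun g => Matrix.vecMul (coords (mono ν a)) (sigmaCirc g) = coords (mono ν a * g)) g
    (fun g₁ g₂ h₁ h₂ => ?_) fun μ b => ?_
  · rw [sigmaCirc_add, Matrix.vecMul_add, h₁, h₂, mul_add, coords_add]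
  have hv : (fun j => monomial ν (vec a j) : Fin n → F[X]) = (X ^ ν : F[X]) • (C ∘ vec a) := by
    exact funext fun j => C_mul_X_pow_eq_monomial.symm.trans (mul_comm _ _)
  have hv' : (fun j => monomial (ν + μ) (vec ((σ ^ μ) a * b) j) : Fin n → F[X]) =
      (X ^ (ν + μ) : F[X]) • (C ∘ vec ((σ ^ μ) a * b)) := by
    exact funext fun j => C_mul_X_pow_eq_monomial.symm.trans (mul_comm _ _)
  rw [mono_mul_mono, coords_mono, coords_mono, hv, hv', sigmaCirc_mono, Matrix.vecMul_smul,
    Matrix.smul_vecMul, smul_smul, ← pow_add, add_comm μ ν, ← vec_vecMul_circ,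
    ← vec_vecMul_autMatrix_pow, Matrix.vecMul_vecMul]
  congr 1
  funext j
  exact (RingHom.map_vecMul C _ _ j).symm

theorem mem_im_sigmaCirc {g : Piret σ} {v : Fin n → F[X]} :
    v ∈ im (sigmaCirc g) ↔ ∃ f : Piret σ, coords (f * g) = v := by
  constructor
  · rintro ⟨u, rfl⟩
    refine ⟨polyForm σ u, ?_⟩
    rw [← coords_vecMul_sigmaCirc, coords_polyForm]
    rfl
  · rintro ⟨f, rfl⟩
    exact ⟨coords f, coords_vecMul_sigmaCirc f g⟩

theorem isSigmaCyclic_im (g : Piret σ) : IsSigmaCyclic σ (im (sigmaCirc g)) := by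
  intro v hv
  obtain ⟨f, rfl⟩ := mem_im_sigmaCirc.1 hv
  refine ⟨coords (mono 0 (xA F n) * f * g), mem_im_sigmaCirc.2 ⟨_, rfl⟩, ?_⟩
  rw [polyForm_coords, polyForm_coords, mul_assoc]

end Piret

end Algebra

section Components

variable {F : Type*} [Field F] {n r : ℕ} [NeZero (n : F)]

/-! ### Primitive idempotents -/

theorem decomp_idem (P : PrimeFactors F n r) (k : Fin r) :
    decomp P (idem P k) = Pi.single k 1 := (decomp P).apply_symm_apply _

theorem decomp_mk (P : PrimeFactors F n r) (f : F[X]) (k : Fin r) :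
    decomp P (AdjoinRoot.mk _ f) k = AdjoinRoot.mk (P.π k) f := residues_mk P f k

theorem sum_idem (P : PrimeFactors F n r) : ∑ k, idem P k = 1 := by
  apply (decomp P).injective
  rw [map_sum, map_one]
  simp only [decomp_idem]
  exact Finset.univ_sum_single 1

theorem idem_mul_self (P : PrimeFactors F n r) (k : Fin r) : idem P k * idem P k = idem P k := by
  apply (decomp P).injective
  rw [map_mul, decomp_idem, ← Pi.single_mul, mul_one]

theorem idem_mul_of_ne (P : PrimeFactors F n r) {k l : Fin r} (h : k ≠ l) :
    idem P k * idem P l = 0 := by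
  apply (decomp P).injective
  rw [map_mul, decomp_idem, decomp_idem, map_zero]
  funext j
  by_cases hj : j = k
  · subst hj; simp [h]
  · simp [hj]

theorem decomp_idem_mul (P : PrimeFactors F n r) (k : Fin r) (a : CycAlg F n) :
    decomp P (idem P k * a) = Pi.single k (decomp P a k) := by
  rw [map_mul, decomp_idem]
  funext j
  by_cases hj : j = k
  · subst hj; simp
  · simp [hj]

theorem idem_mul_eq_zero_iff (P : PrimeFactors F n r) (k : Fin r) (a : CycAlg F n) :
    idem P k * a = 0 ↔ decomp P a k = 0 := by
  rw [← (decomp P).map_eq_zero_iff, decomp_idem_mul, Pi.single_eq_zero_iff]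

theorem idem_ne_zero (P : PrimeFactors F n r) (k : Fin r) : idem P k ≠ 0 := by
  have := Fact.mk (P.irreducible k)
  intro h
  have h1 := (idem_mul_eq_zero_iff P k 1).1 (by rw [h, zero_mul])
  rw [map_one] at h1
  exact one_ne_zero h1

/-- The component `A e_k` is a copy of the field `F[x]/(π_k)`. -/
theorem eq_zero_or_eq_zero_of_idem_mul (P : PrimeFactors F n r) (k : Fin r) {a b : CycAlg F n}
    (h : idem P k * (a * b) = 0) : idem P k * a = 0 ∨ idem P k * b = 0 := by
  have := Fact.mk (P.irreducible k)
  simp only [idem_mul_eq_zero_iff, map_mul, Pi.mul_apply, mul_eq_zero] at h ⊢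
  exact h

theorem idem_mul_mk_eq_zero_iff (P : PrimeFactors F n r) (k : Fin r) (f : F[X]) :
    idem P k * AdjoinRoot.mk _ f = 0 ↔ P.π k ∣ f := by
  rw [idem_mul_eq_zero_iff, decomp_mk, AdjoinRoot.mk_eq_zero]

/-- Automorphisms permute the primitive idempotents. -/
theorem exists_map_idem_eq (P : PrimeFactors F n r) (τ : CycAlg F n ≃ₐ[F] CycAlg F n)
    (k : Fin r) : ∃ m, τ (idem P k) = idem P m := by
  have hne : τ (idem P k) ≠ 0 := by
    rw [Ne, map_eq_zero_iff τ τ.injective]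
    exact idem_ne_zero P k
  -- The image of `e_k` inherits the absence of zero divisors. For an `e_m` with `τ(e_k) e_m ≠ 0`,
  -- it follows that `τ(e_k)` kills `1 - e_m` and `e_m` kills `1 - τ(e_k)`; so both equal their
  -- product.
  have hprime : ∀ a b, τ (idem P k) * (a * b) = 0 → τ (idem P k) * a = 0 ∨
      τ (idem P k) * b = 0 := by
    intro a b h
    have h' := congrArg τ.symm h
    simp only [map_mul, AlgEquiv.symm_apply_apply, map_zero] at h'
    refine (eq_zero_or_eq_zero_of_idem_mul P k h').imp (fun h => ?_) fun h => ?_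
    · simpa using congrArg τ h
    · simpa using congrArg τ h
  have hex : ∃ m, τ (idem P k) * idem P m ≠ 0 := by
    by_contra! hcon
    apply hne
    rw [← mul_one (τ (idem P k)), ← sum_idem P, Finset.mul_sum]
    exact Finset.sum_eq_zero fun m _ => hcon m
  obtain ⟨m, hm⟩ := hex
  refine ⟨m, ?_⟩
  have h1 : τ (idem P k) * (1 - idem P m) = 0 := by
    refine (hprime (idem P m) (1 - idem P m) ?_).resolve_left hm
    rw [mul_sub, mul_one, idem_mul_self, sub_self, mul_zero]
  have h2 : idem P m * (1 - τ (idem P k)) = 0 := by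
    refine (eq_zero_or_eq_zero_of_idem_mul P m (a := τ (idem P k)) ?_).resolve_left
      (by rwa [mul_comm])
    rw [mul_sub, mul_one, ← map_mul, idem_mul_self, sub_self, mul_zero]
  rw [mul_sub, mul_one, sub_eq_zero] at h1 h2
  rw [h1, mul_comm, ← h2]

/-- The classes of `x^i e_k`, `i < deg π_k`, span the component `A e_k`. -/
theorem exists_mul_idem_eq_sum (P : PrimeFactors F n r) (k : Fin r) (a : CycAlg F n) :
    ∃ c : Fin (P.π k).natDegree → F, a * idem P k = ∑ i, c i • (xA F n ^ (i : ℕ) * idem P k) := by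
  induction a using AdjoinRoot.induction_on with
  | ih f =>
    refine ⟨fun i => (f %ₘ P.π k).coeff i, ?_⟩
    have h1 : AdjoinRoot.mk (X ^ n - 1) f * idem P k =
        AdjoinRoot.mk (X ^ n - 1) (f %ₘ P.π k) * idem P k := by
      rw [← sub_eq_zero, ← sub_mul, ← map_sub, mul_comm, idem_mul_mk_eq_zero_iff,
        modByMonic_eq_sub_mul_div, sub_sub_cancel]
      exact dvd_mul_right _ _
    rw [h1]
    conv_lhs =>
      rw [(f %ₘ P.π k).as_sum_range_C_mul_X_pow' (natDegree_modByMonic_lt f (P.monic k)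
        (P.irreducible k).ne_one), map_sum, Finset.sum_mul, Finset.sum_range]
    refine Finset.sum_congr rfl fun i _ => ?_
    rw [map_mul, ← xA_pow, AdjoinRoot.mk_C, mul_assoc, Algebra.smul_def]
    rfl

theorem eq_zero_of_sum_xA_pow_mul_idem (P : PrimeFactors F n r) (k : Fin r)
    (c : Fin (P.π k).natDegree → F) (h : ∑ i, c i • (xA F n ^ (i : ℕ) * idem P k) = 0) : c = 0 := by
  set f : F[X] := ∑ i, C (c i) * X ^ (i : ℕ) with hf
  have h1 : idem P k * AdjoinRoot.mk (X ^ n - 1) f = 0 := by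
    rw [← h, hf, map_sum, Finset.mul_sum]
    refine Finset.sum_congr rfl fun i _ => ?_
    rw [map_mul, ← xA_pow, AdjoinRoot.mk_C, mul_comm, mul_assoc, Algebra.smul_def]
    rfl
  rw [idem_mul_mk_eq_zero_iff] at h1
  have hdeg : f.degree < (P.π k).degree := by
    rw [degree_eq_natDegree (P.monic k).ne_zero]
    refine (degree_sum_fin_lt c).trans_le le_rfl
  have hf0 : f = 0 := eq_zero_of_dvd_of_degree_lt h1 hdeg
  funext i
  have := congrArg (fun p => p.coeff (i : ℕ)) hf0
  simpa [hf, coeff_X_pow, Fin.val_inj] using this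

namespace Piret

variable {σ : CycAlg F n ≃ₐ[F] CycAlg F n}

/-! ### Leading monomials of the components -/

/-- Moving `e_k` past `z^ν` twists it, so the coefficient of `z^ν` in `g^(k)` lies in the component
of `σ^ν(e_k)`. -/
theorem coeff_comp (P : PrimeFactors F n r) (g : Piret σ) (k : Fin r) (ν : ℕ) :
    (comp P g k).coeff ν = (σ ^ ν) (idem P k) * g.coeff ν :=
  coeff_mono_zero_mul _ _ _

theorem coeff_degz_ne_zero {f : Piret σ} (h : f ≠ 0) : f.coeff f.degz ≠ 0 :=
  fun h0 => h (leadingCoeff_eq_zero.1 h0)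

theorem coeff_eq_zero_of_degz_lt {f : Piret σ} {ν : ℕ} (h : f.degz < ν) : f.coeff ν = 0 :=
  coeff_eq_zero_of_natDegree_lt h

theorem mem_termSupport (P : PrimeFactors F n r) (f : Piret σ) (q : ℕ ×ₗ Fin r) :
    q ∈ termSupport P f ↔ idem P (ofLex q).2 * f.coeff (ofLex q).1 ≠ 0 := by
  classical
  rw [termSupport, Finset.mem_filter]
  refine ⟨fun h => h.2, fun h => ⟨?_, h⟩⟩
  rw [Finset.mem_map]
  refine ⟨ofLex q, ?_, rfl⟩
  rw [Finset.mem_product]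
  refine ⟨mem_support_iff.2 fun h0 => h ?_, Finset.mem_univ _⟩
  rw [coeff, h0, mul_zero]

variable (P : PrimeFactors F n r) (g : Piret σ) {k m : Fin r}

theorem top_mem_termSupport_comp (hk : comp P g k ≠ 0)
    (hm : (σ ^ (comp P g k).degz) (idem P k) = idem P m) :
    toLex ((comp P g k).degz, m) ∈ termSupport P (comp P g k) := by
  rw [mem_termSupport]
  change idem P m * (comp P g k).coeff (comp P g k).degz ≠ 0
  have h := coeff_degz_ne_zero hk
  rw [coeff_comp, hm] at h ⊢
  rwa [← mul_assoc, idem_mul_self]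

/-- At each power of `z` only one idempotent can occur in `g^(k)`, so the order among the
idempotents plays no role. -/
theorem leadMono_comp (hk : comp P g k ≠ 0)
    (hm : (σ ^ (comp P g k).degz) (idem P k) = idem P m) :
    leadMono P (comp P g k) = mono (comp P g k).degz (idem P m) := by
  have hmem := top_mem_termSupport_comp P g hk hm
  have hne : (termSupport P (comp P g k)).Nonempty := ⟨_, hmem⟩
  have hmax : (termSupport P (comp P g k)).max' hne = toLex ((comp P g k).degz, m) := by
    refine le_antisymm (Finset.max'_le _ _ _ fun q hq => ?_) (Finset.le_max' _ _ hmem)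
    rw [mem_termSupport] at hq
    rw [Prod.Lex.le_iff]
    change (ofLex q).1 < (comp P g k).degz ∨ (ofLex q).1 = (comp P g k).degz ∧ (ofLex q).2 ≤ m
    rcases lt_trichotomy (ofLex q).1 (comp P g k).degz with h | h | h
    · exact Or.inl h
    · refine Or.inr ⟨h, le_of_eq ?_⟩
      by_contra hqm
      apply hq
      rw [h, coeff_comp, hm, ← mul_assoc, idem_mul_of_ne P hqm, zero_mul]
    · exact absurd (by rw [coeff_eq_zero_of_degz_lt h, mul_zero]) hq
  rw [leadMono, dif_pos hne, hmax]
  rfl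

variable {P g}

/-- In a reduced polynomial the leading monomials of different components involve different
idempotents. -/
theorem Reduced.idem_ne {l m' : Fin r} (hred : Reduced P g) (hkl : k ≠ l)
    (hk : comp P g k ≠ 0) (hl : comp P g l ≠ 0)
    (hm : (σ ^ (comp P g k).degz) (idem P k) = idem P m)
    (hm' : (σ ^ (comp P g l).degz) (idem P l) = idem P m') : m ≠ m' := by
  wlog hle : (comp P g l).degz ≤ (comp P g k).degz generalizing k l m m'
  · exact (this hkl.symm hl hk hm' hm (not_le.1 hle).le).symm
  rintro rfl
  refine hred k l hkl hk hl _ (top_mem_termSupport_comp P g hk hm) ?_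
  rw [leadMono_comp P g hl hm']
  set d := (comp P g k).degz
  set d' := (comp P g l).degz
  -- If the idempotents agree, the top term of `g^(k)` is a left multiple of the leading monomial of
  -- `g^(l)`; the inverse of `σ^d'` undoes the twist from passing `z^d'`.
  refine ⟨mono (d - d') ((σ ^ d').symm (idem P m * (comp P g k).coeff d)), ?_⟩
  rw [mono_mul_mono, Nat.sub_add_cancel hle, AlgEquiv.apply_symm_apply, mul_right_comm,
    idem_mul_self]
  rfl

/-! ### A row reduced encoder -/

variable (P g)

/-- The element `x^i e_k g` of the left ideal generated by `g`. -/
def gen (k : Fin r) (i : ℕ) : Piret σ := mono 0 (xA F n ^ i * idem P k) * g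

theorem coeff_gen (k : Fin r) (i ν : ℕ) :
    (gen P g k i).coeff ν = (σ ^ ν) (xA F n ^ i) * (comp P g k).coeff ν := by
  rw [gen, coeff_mono_zero_mul, map_mul, mul_assoc, coeff_comp]

theorem natDegree_coords_gen_le (k : Fin r) (i : ℕ) (j : Fin n) :
    (coords (gen P g k i) j).natDegree ≤ (comp P g k).degz := by
  rw [natDegree_le_iff_coeff_eq_zero]
  intro ν hν
  rw [coeff_coords, coeff_gen, coeff_eq_zero_of_degz_lt hν, mul_zero, ← vecLin_apply, map_zero,
    Pi.zero_apply]

variable {P g}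

/-- Index set of the generators `x^i e_k g`, `k ∈ T_g`, `i < deg π_k`. -/
abbrev GenIndex (P : PrimeFactors F n r) (g : Piret σ) : Type :=
  Σ k : supp P g, Fin (P.π k).natDegree

theorem mem_supp : k ∈ supp P g ↔ comp P g k ≠ 0 := by
  simp [supp]

theorem linearIndependent_leading (hred : Reduced P g) :
    LinearIndependent F fun (q : GenIndex P g) (j : Fin n) =>
      (coords (gen P g q.1 q.2) j).coeff (comp P g q.1).degz := by
  choose m hm using fun k => exists_map_idem_eq P (σ ^ (comp P g k).degz) k
  have hrow : (fun (q : GenIndex P g) (j : Fin n) =>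
      (coords (gen P g q.1 q.2) j).coeff (comp P g q.1).degz) = fun q =>
      vecLin F n ((gen P g q.1 q.2).coeff (comp P g q.1).degz) := by
    funext q j
    exact coeff_coords _ _ _
  rw [hrow]
  have hker : LinearMap.ker (vecLin F n) = ⊥ := LinearMap.ker_eq_bot.2 vec_injective
  refine LinearIndependent.map' (v := fun q : GenIndex P g =>
    (gen P g q.1 q.2).coeff (comp P g q.1).degz) ?_ _ hker
  rw [Fintype.linearIndependent_iff]
  intro c hc
  -- The part of the relation belonging to `k`, before it is twisted by `σ^(d_k)` and multiplied by
  -- the top coefficient.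
  set y : supp P g → CycAlg F n := fun k =>
    ∑ i : Fin (P.π k).natDegree, c ⟨k, i⟩ • (xA F n ^ (i : ℕ) * idem P k) with hy
  have hsum : ∑ k : supp P g, (σ ^ (comp P g k).degz) (y k) * g.coeff (comp P g k).degz = 0 := by
    rw [← hc, Fintype.sum_sigma]
    refine Finset.sum_congr rfl fun k _ => ?_
    rw [hy, map_sum, Finset.sum_mul]
    refine Finset.sum_congr rfl fun i _ => ?_
    rw [map_smul, smul_mul_assoc, gen, coeff_mono_zero_mul]
  have hblock : ∀ k : supp P g, (σ ^ (comp P g k).degz) (y k) =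
      idem P (m k) * (σ ^ (comp P g k).degz) (y k) := by
    intro k
    rw [← hm, ← map_mul]
    congr 1
    rw [hy, Finset.mul_sum]
    refine Finset.sum_congr rfl fun i _ => ?_
    rw [mul_smul_comm, mul_left_comm, idem_mul_self]
  have hzero : ∀ k, y k = 0 := by
    intro k
    have hk := mem_supp.1 k.2
    -- Multiplying by `e_(m_k)` isolates the summand of `k`, since the other summands lie in
    -- different components.
    have h1 := congrArg (idem P (m k) * ·) hsum
    simp only [mul_zero, Finset.mul_sum] at h1
    rw [Finset.sum_eq_single k] at h1
    · rcases eq_zero_or_eq_zero_of_idem_mul P (m k) h1 with h | h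
      · rw [← hblock] at h
        exact (map_eq_zero_iff _ (AlgEquiv.injective _)).1 h
      · refine absurd ?_ (coeff_degz_ne_zero hk)
        rw [coeff_comp, hm, h]
    · intro l _ hlk
      have := hred.idem_ne (fun h => hlk (Subtype.ext h.symm)) hk (mem_supp.1 l.2) (hm k) (hm l)
      rw [hblock l, ← mul_assoc, ← mul_assoc, idem_mul_of_ne P this, zero_mul, zero_mul]
    · intro h
      exact absurd (Finset.mem_univ k) h
  rintro ⟨k, i⟩
  exact congrFun (eq_zero_of_sum_xA_pow_mul_idem P k (fun i => c ⟨k, i⟩) (hzero k)) i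

/-- In `z^ν a g` the power `z^ν` is a scalar, `a` splits into the `a e_k`, and each of these is an
`F`-combination of the `x^i e_k`; indices outside `T_g` contribute zero. -/
theorem span_coords_gen (P : PrimeFactors F n r) (g : Piret σ) :
    Submodule.span F[X] (Set.range fun q : GenIndex P g => coords (gen P g q.1 q.2)) =
      im (sigmaCirc g) := by
  refine le_antisymm ?_ ?_
  · rw [Submodule.span_le]
    rintro _ ⟨q, rfl⟩
    exact mem_im_sigmaCirc.2 ⟨_, rfl⟩
  intro v hv
  obtain ⟨f, rfl⟩ := mem_im_sigmaCirc.1 hv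
  refine ind (fun f => coords (f * g) ∈ Submodule.span F[X]
    (Set.range fun q : GenIndex P g => coords (gen P g q.1 q.2))) f
    (fun f₁ f₂ h₁ h₂ => ?_) fun ν a => ?_
  · rw [add_mul, coords_add]
    exact Submodule.add_mem _ h₁ h₂
  have hsplit : (mono ν a * g : Piret σ) = mono ν 1 * (mono 0 a * g) := by
    rw [← mul_assoc, mono_mul_mono]
    simp
  rw [hsplit, coords_mono_one_mul]
  refine Submodule.smul_mem _ _ ?_
  have hdec : (mono 0 a * g : Piret σ) = ∑ k, mono 0 (a * idem P k) * g := by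
    refine ext_coeff fun μ => ?_
    rw [coeff_sum]
    simp only [coeff_mono_zero_mul]
    rw [← Finset.sum_mul, ← map_sum, ← Finset.mul_sum, sum_idem, mul_one]
  rw [hdec, coords_sum]
  refine Submodule.sum_mem _ fun k _ => ?_
  by_cases hk : k ∈ supp P g
  · obtain ⟨c, hc⟩ := exists_mul_idem_eq_sum P k a
    have : (mono 0 (a * idem P k) * g : Piret σ) =
        ∑ i, mono 0 (c i • (xA F n ^ (i : ℕ) * idem P k)) * g := by
      refine ext_coeff fun μ => ?_
      rw [coeff_sum]
      simp only [coeff_mono_zero_mul]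
      rw [← Finset.sum_mul, ← map_sum, hc]
    rw [this, coords_sum]
    refine Submodule.sum_mem _ fun i _ => ?_
    rw [coords_smul_mul]
    exact Submodule.smul_mem _ _ (Submodule.subset_span ⟨⟨⟨k, hk⟩, i⟩, rfl⟩)
  · have h0 : comp P g k = 0 := not_not.1 fun h => hk (mem_supp.2 h)
    have : (mono 0 (a * idem P k) * g : Piret σ) = mono 0 a * comp P g k := by
      rw [comp, ← mul_assoc, mono_mul_mono]
      simp
    rw [this, h0, mul_zero, coords_zero]
    exact Submodule.zero_mem _

theorem Reduced.hasComplexity (hred : Reduced P g) :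
    HasComplexity (im (sigmaCirc g))
      (∑ i ∈ supp P g, (P.π i).natDegree * (comp P g i).degz) := by
  let e := (Fintype.equivFin (GenIndex P g)).symm
  have h := hasComplexity_of_rowReduced (V := im (sigmaCirc g))
    (Matrix.of fun p => coords (gen P g (e p).1 (e p).2)) (fun p => (comp P g (e p).1).degz)
    (fun p j => natDegree_coords_gen_le P g _ _ j)
    ((linearIndependent_leading hred).comp e e.injective) ?_
  · convert h using 1
    rw [Equiv.sum_comp e fun q : GenIndex P g => (comp P g q.1).degz, Fintype.sum_sigma,
      ← Finset.sum_coe_sort]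
    simp
  · rw [im, range_vecMulLinear, ← span_coords_gen P g]
    congr 1
    exact e.surjective.range_comp fun q : GenIndex P g => coords (gen P g q.1 q.2)

end Piret

end Components

end CyclicConv

end

theorem corollary7p16 {F : Type*} [Field F] [Finite F] {n r : ℕ} [NeZero (n : F)]
    (P : CyclicConv.PrimeFactors F n r)
    (σ : CyclicConv.CycAlg F n ≃ₐ[F] CyclicConv.CycAlg F n)
    (g : CyclicConv.Piret σ) (hred : CyclicConv.Piret.Reduced P g)
    (hbasic : CyclicConv.Basic (CyclicConv.sigmaCirc g)) :
    CyclicConv.IsConvCode (CyclicConv.im (CyclicConv.sigmaCirc g)) ∧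
    CyclicConv.IsSigmaCyclic σ (CyclicConv.im (CyclicConv.sigmaCirc g)) ∧
    CyclicConv.HasComplexity (CyclicConv.im (CyclicConv.sigmaCirc g))
      (∑ i ∈ CyclicConv.Piret.supp P g,
        (P.π i).natDegree * (CyclicConv.Piret.comp P g i).degz) := by
  exact ⟨CyclicConv.isConvCode_of_basic hbasic, CyclicConv.Piret.isSigmaCyclic_im g,
    hred.hasComplexity⟩
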